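/- For $p\in\mathbb R^2$ and $r>0$ let $D(p,r)$ denote the closed Euclidean disc with center $p$ and radius $r$, let $D(p,r)^o$ be its interior, and let $\lambda_2$ be two-dimensional Lebesgue measure. Let $R\in[2\sqrt2,4]$, let $D=D(0,R)\setminus D(0,2)^o\subset\mathbb R^2$, and put $$a=\sqrt{\frac{-R^4+16R^2}{8(R^2+2)}} .$$ Then every Lebesgue measurable set $A\subset D$ with $\operatorname{diam}A\le 2$ satisfies $$\lambda_2(A)\le R^2\arcsin\left(\frac aR\right)-4\arcsin\left(\frac a2\right)+2\arccos(a).$$ The bound is optimal: for $s=\left(\sqrt{4-a^2}+\sqrt{1-a^2},\,0\right)$ the set $D(s,1)\cap D$ has diameter at most $2$ and its Lebesgue measure equals the right-hand side. -/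

import Mathlib

open MeasureTheory Metric Set

/-- The annulus `D(0,R) \ D(0,2)ᵒ` in the Euclidean plane. -/
def annulus (R : ℝ) : Set (EuclideanSpace ℝ (Fin 2)) :=
  closedBall 0 R \ interior (closedBall 0 2)

/-- Half of the height of the rectangle spanned by the corners of the extremal set. -/
noncomputable def cornerHeight (R : ℝ) : ℝ :=
  Real.sqrt ((-R ^ 4 + 16 * R ^ 2) / (8 * (R ^ 2 + 2)))

/-- The right-hand side of the isodiametric inequality on the annulus. -/
noncomputable def annulusBound (R : ℝ) : ℝ :=
  R ^ 2 * Real.arcsin (cornerHeight R / R) - 4 * Real.arcsin (cornerHeight R / 2)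
    + 2 * Real.arccos (cornerHeight R)

/-- The centre of the extremal unit disc: the intersection of the diagonals of the rectangle
whose left corners have norm `2`, whose half-height is `cornerHeight R` and whose diagonals have
length `2`. -/
noncomputable def extremalCenter (R : ℝ) : EuclideanSpace ℝ (Fin 2) :=
  !₂[Real.sqrt (4 - cornerHeight R ^ 2) + Real.sqrt (1 - cornerHeight R ^ 2), 0]

/-!
Let `A` be a subset of the annulus `2 ≤ |z| ≤ R` of diameter at most `2`. Replacing `A` by the part
of its closed convex hull in the annulus, one may assume that `A` is compact and that the norms of
its points fill an interval `[x, y]`; after a rotation `A` lies in the right half plane. The area is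
computed in polar coordinates, with the plane identified with `ℂ`.

Let `ℓ r` be the angular measure of `A` on the circle of radius `r`. By the law of cosines, points
of `A` of norms `r` and `s` differ in argument by at most the angle `φ` opposite to the side `2` in
a triangle with sides `r`, `s`, `2`, and this forces `ℓ r + ℓ s ≤ 2 φ`
(`volume_add_volume_le_of_abs_sub_le`). The inequality is used for the pairs with
`r² + s² = x² + y²`, because the reflection `r ↦ s` preserves `r dr` on `[x, y]`
(`lintegral_reflect`). For these pairs the bound is attained by the unit disc about a point `σ` with
`2σ² + 2 = x² + y²`: by the parallelogram law, antipodal points of its boundary have norms paired in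
this way (`halfAngle_add_halfAngle`). So `A` has at most the area of the part `E x y` of this disc
with norms in `[x, y]` (`volume_le_volume_discInAnnulus`).

It remains to see that the area of `E x y` is largest for `[x, y] = [2, R]`. If `[x', y']` is
slightly larger than `[x, y]`, the disc of `E x y` still meets all circles with radii in `[x', y']`,
so the comparison above applies to it and the area of `E x' y'` is at least that of `E x y`. The area
of `E x y` has a closed form which is continuous in `x` and `y`, so this local monotonicity
propagates along the segment from `(x, y)` to `(2, R)` (`volume_discInAnnulus_midpointNorm_le`). The
closed form at `(2, R)` is the asserted bound.
-/

/-! ### Linear sets with bounded mutual distances -/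

/-- Two sets of reals all of whose mutual distances are at most `φ` have total length at most
`2 * φ`: each of the two "crossed" differences of suprema and infima is at most `φ`. -/
lemma volume_add_volume_le_of_abs_sub_le {X Y : Set ℝ} {φ : ℝ} (hX : X.Nonempty)
    (hY : Y.Nonempty) (h : ∀ s ∈ X, ∀ t ∈ Y, |s - t| ≤ φ) :
    volume X + volume Y ≤ ENNReal.ofReal (2 * φ) := by
  obtain ⟨s₀, hs₀⟩ := hX
  obtain ⟨t₀, ht₀⟩ := hY
  have hXa : BddAbove X := ⟨t₀ + φ, fun s hs => by linarith [(abs_le.1 (h s hs t₀ ht₀)).2]⟩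
  have hXb : BddBelow X := ⟨t₀ - φ, fun s hs => by linarith [(abs_le.1 (h s hs t₀ ht₀)).1]⟩
  have hYa : BddAbove Y := ⟨s₀ + φ, fun t ht => by linarith [(abs_le.1 (h s₀ hs₀ t ht)).1]⟩
  have hYb : BddBelow Y := ⟨s₀ - φ, fun t ht => by linarith [(abs_le.1 (h s₀ hs₀ t ht)).2]⟩
  have h1 : sSup X ≤ sInf Y + φ := by
    refine csSup_le ⟨s₀, hs₀⟩ fun s hs => ?_
    have : s - φ ≤ sInf Y :=
      le_csInf ⟨t₀, ht₀⟩ fun t ht => by linarith [(abs_le.1 (h s hs t ht)).2]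
    linarith
  have h2 : sSup Y ≤ sInf X + φ := by
    refine csSup_le ⟨t₀, ht₀⟩ fun t ht => ?_
    have : t - φ ≤ sInf X :=
      le_csInf ⟨s₀, hs₀⟩ fun s hs => by linarith [(abs_le.1 (h s hs t ht)).1]
    linarith
  have hXi : sInf X ≤ sSup X := (csInf_le hXb hs₀).trans (le_csSup hXa hs₀)
  have hYi : sInf Y ≤ sSup Y := (csInf_le hYb ht₀).trans (le_csSup hYa ht₀)
  calc volume X + volume Y
      ≤ volume (Icc (sInf X) (sSup X)) + volume (Icc (sInf Y) (sSup Y)) :=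
        add_le_add (measure_mono (subset_Icc_csInf_csSup hXb hXa))
          (measure_mono (subset_Icc_csInf_csSup hYb hYa))
    _ = ENNReal.ofReal ((sSup X - sInf X) + (sSup Y - sInf Y)) := by
        rw [Real.volume_Icc, Real.volume_Icc, ← ENNReal.ofReal_add] <;> linarith
    _ ≤ ENNReal.ofReal (2 * φ) := ENNReal.ofReal_le_ofReal (by linarith)

/-! ### Area in polar coordinates -/

/-- The set of arguments in `(-π, π)` of the points of `S` of norm `r`. -/
def angularSlice (S : Set ℂ) (r : ℝ) : Set ℝ :=
  {θ | θ ∈ Ioo (-Real.pi) Real.pi ∧ Complex.polarCoord.symm (r, θ) ∈ S}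

/-- The closed annulus of the points of norm between `x` and `y`. -/
def complexAnnulus (x y : ℝ) : Set ℂ := {z | x ≤ ‖z‖ ∧ ‖z‖ ≤ y}

lemma isClosed_complexAnnulus (x y : ℝ) : IsClosed (complexAnnulus x y) :=
  (isClosed_le continuous_const continuous_norm).inter
    (isClosed_le continuous_norm continuous_const)

lemma measurable_polarCoord_symm : Measurable (Complex.polarCoord.symm : ℝ × ℝ → ℂ) := by
  have : (Complex.polarCoord.symm : ℝ × ℝ → ℂ)
      = fun p => (p.1 : ℂ) * (Real.cos p.2 + Real.sin p.2 * Complex.I) := by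
    funext p; exact Complex.polarCoord_symm_apply p
  rw [this]
  exact Continuous.measurable (by fun_prop)

lemma measurableSet_polar_region {S : Set ℂ} (hS : MeasurableSet S) :
    MeasurableSet {p : ℝ × ℝ | p.2 ∈ Ioo (-Real.pi) Real.pi ∧ Complex.polarCoord.symm p ∈ S} :=
  (measurable_snd measurableSet_Ioo).inter (measurable_polarCoord_symm hS)

lemma measurable_volume_angularSlice {S : Set ℂ} (hS : MeasurableSet S) :
    Measurable fun r => volume (angularSlice S r) :=
  measurable_measure_prodMk_left (measurableSet_polar_region hS)

lemma volume_eq_lintegral_angularSlice {S : Set ℂ} (hS : MeasurableSet S) :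
    volume S = ∫⁻ r in Ioi (0 : ℝ), ENNReal.ofReal r * volume (angularSlice S r) := by
  have h1 : volume S = ∫⁻ z, S.indicator 1 z := by
    rw [lintegral_indicator_one hS]
  rw [h1, ← Complex.lintegral_comp_polarCoord_symm, polarCoord_target, Measure.volume_eq_prod,
    ← Measure.prod_restrict, lintegral_prod]
  · refine lintegral_congr fun r => ?_
    simp only [smul_eq_mul]
    rw [lintegral_const_mul]
    · congr 1
      have hm : MeasurableSet {θ : ℝ | Complex.polarCoord.symm (r, θ) ∈ S} :=
        (measurable_polarCoord_symm.comp measurable_prodMk_left) hS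
      have : (fun θ : ℝ => S.indicator (1 : ℂ → ENNReal) (Complex.polarCoord.symm (r, θ)))
          = {θ : ℝ | Complex.polarCoord.symm (r, θ) ∈ S}.indicator 1 := by
        funext θ; rfl
      rw [this, lintegral_indicator_one hm, Measure.restrict_apply hm]
      congr 1
      ext θ
      simp [angularSlice, and_comm]
    · exact (measurable_one.indicator hS).comp
        (measurable_polarCoord_symm.comp measurable_prodMk_left)
  · refine Measurable.aemeasurable ?_
    exact (ENNReal.measurable_ofReal.comp measurable_fst).smul
      ((measurable_one.indicator hS).comp measurable_polarCoord_symm)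

lemma norm_polarCoord_symm_of_pos {r : ℝ} (hr : 0 < r) (θ : ℝ) :
    ‖Complex.polarCoord.symm (r, θ)‖ = r := by
  rw [Complex.norm_polarCoord_symm, abs_of_pos hr]

lemma volume_eq_lintegral_of_subset_complexAnnulus {S : Set ℂ} (hS : MeasurableSet S) {x y : ℝ}
    (hsub : S ⊆ complexAnnulus x y) :
    volume S = ∫⁻ r in Ioo x y, ENNReal.ofReal r * volume (angularSlice S r) := by
  rw [volume_eq_lintegral_angularSlice hS, setLIntegral_congr (Ioo_ae_eq_Icc (a := x) (b := y))]
  -- For negative `r` the slice may be non-empty, but there `ENNReal.ofReal r = 0`.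
  have hpos : (fun r => ENNReal.ofReal r * volume (angularSlice S r)).support ⊆ Ioi 0 := by
    intro r hr
    by_contra h
    simp only [mem_Ioi, not_lt] at h
    simp [ENNReal.ofReal_of_nonpos h] at hr
  rw [setLIntegral_eq_of_support_subset hpos, setLIntegral_eq_of_support_subset]
  intro r hr
  by_contra h
  have : angularSlice S r = ∅ := by
    refine eq_empty_of_forall_notMem fun θ hθ => h ?_
    have := hsub hθ.2
    rwa [complexAnnulus, mem_ofPred_eq, norm_polarCoord_symm_of_pos (hpos hr)] at this
  simp [this] at hr

/-! ### Pairs of radii -/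

/-- The reflection `r ↦ √(x² + y² - r²)` of `(x, y)` preserves the measure `r dr`. -/
lemma lintegral_reflect {x y : ℝ} (hx : 0 < x) (f : ℝ → ENNReal) :
    ∫⁻ r in Ioo x y, ENNReal.ofReal r * f r
      = ∫⁻ r in Ioo x y, ENNReal.ofReal r * f (√(x ^ 2 + y ^ 2 - r ^ 2)) := by
  set τ : ℝ → ℝ := fun r => √(x ^ 2 + y ^ 2 - r ^ 2) with hτ
  have hmaps : ∀ r ∈ Ioo x y, τ r ∈ Ioo x y := by
    intro r hr
    have hr0 : 0 < r := hx.trans hr.1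
    have hy0 : 0 < y := hr0.trans hr.2
    constructor
    · exact Real.lt_sqrt_of_sq_lt (by nlinarith [hr.1, hr.2])
    · exact (Real.sqrt_lt' hy0).2 (by nlinarith [hr.1, hr.2])
  have hinv : ∀ r ∈ Ioo x y, τ (τ r) = r := by
    intro r hr
    have hr0 : 0 < r := hx.trans hr.1
    simp only [hτ]
    rw [Real.sq_sqrt (by nlinarith [hr.1, hr.2]), sub_sub_cancel, Real.sqrt_sq hr0.le]
  have himg : τ '' Ioo x y = Ioo x y :=
    Subset.antisymm (image_subset_iff.2 hmaps) fun r hr => ⟨τ r, hmaps r hr, hinv r hr⟩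
  have hinj : InjOn τ (Ioo x y) := fun r hr s hs h => by
    rw [← hinv r hr, ← hinv s hs, h]
  have hder : ∀ r ∈ Ioo x y, HasDerivWithinAt τ (-r / τ r) (Ioo x y) r := by
    intro r hr
    have hpos : 0 < x ^ 2 + y ^ 2 - r ^ 2 := by nlinarith [hr.1, hr.2, hx.trans hr.1]
    have h1 : HasDerivAt (fun r : ℝ => x ^ 2 + y ^ 2 - r ^ 2) (-(2 * r)) r := by
      simpa using ((hasDerivAt_pow 2 r).const_sub (x ^ 2 + y ^ 2))
    have h2 := h1.sqrt hpos.ne'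
    refine (h2.congr_deriv ?_).hasDerivWithinAt
    simp only [hτ]
    ring
  have key := lintegral_image_eq_lintegral_abs_deriv_mul measurableSet_Ioo hder hinj
    (fun r => ENNReal.ofReal r * f r)
  rw [himg] at key
  rw [key]
  refine setLIntegral_congr_fun measurableSet_Ioo fun r hr => ?_
  have h0 : 0 < r := hx.trans hr.1
  have h1 : 0 < τ r := hx.trans (hmaps r hr).1
  rw [← mul_assoc, ← ENNReal.ofReal_mul (abs_nonneg _)]
  congr 2
  rw [abs_div, abs_neg, abs_of_pos h0, abs_of_pos h1]
  field_simp

/-- To compare integrals against `r dr`, it suffices to compare sums over pairs of reflected radii. -/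
lemma lintegral_le_of_add_reflect_le {x y : ℝ} (hx : 0 < x) {f g : ℝ → ENNReal}
    (hf : Measurable f) (hg : Measurable g)
    (h : ∀ r ∈ Ioo x y, f r + f (√(x ^ 2 + y ^ 2 - r ^ 2)) ≤ g r + g (√(x ^ 2 + y ^ 2 - r ^ 2))) :
    ∫⁻ r in Ioo x y, ENNReal.ofReal r * f r ≤ ∫⁻ r in Ioo x y, ENNReal.ofReal r * g r := by
  have double : ∀ k : ℝ → ENNReal, Measurable k →
      2 * ∫⁻ r in Ioo x y, ENNReal.ofReal r * k r
        = ∫⁻ r in Ioo x y, ENNReal.ofReal r * (k r + k (√(x ^ 2 + y ^ 2 - r ^ 2))) := by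
    intro k hk
    rw [two_mul]
    nth_rewrite 2 [lintegral_reflect hx]
    rw [← lintegral_add_left (by fun_prop)]
    simp only [mul_add]
  rw [← ENNReal.mul_le_mul_iff_right (a := 2) two_ne_zero ENNReal.ofNat_ne_top, double f hf,
    double g hg]
  exact setLIntegral_mono' measurableSet_Ioo fun r hr => mul_le_mul_right (h r hr) _

/-! ### The part of a unit disc in an annulus -/

/-- The half-angle cut out of the circle of radius `r` about the origin by the unit disc whose
centre has distance `σ` from the origin. -/
noncomputable def halfAngle (σ r : ℝ) : ℝ := Real.arccos ((r ^ 2 + σ ^ 2 - 1) / (2 * r * σ))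

/-- The distance from the origin to the midpoint of a segment of length `2` whose end points have
norms `x` and `y`. -/
noncomputable def midpointNorm (x y : ℝ) : ℝ := √((x ^ 2 + y ^ 2) / 2 - 1)

lemma midpointNorm_sq {x y : ℝ} (hx : 2 ≤ x) :
    midpointNorm x y ^ 2 = (x ^ 2 + y ^ 2) / 2 - 1 :=
  Real.sq_sqrt (by nlinarith)

lemma one_lt_midpointNorm {x y : ℝ} (hx : 2 ≤ x) (hxy : x ≤ y) : 1 < midpointNorm x y :=
  Real.lt_sqrt_of_sq_lt (by nlinarith)

lemma normSq_polar_sub_polar (r s α β : ℝ) :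
    ‖Complex.polarCoord.symm (r, α) - Complex.polarCoord.symm (s, β)‖ ^ 2
      = r ^ 2 + s ^ 2 - 2 * r * s * Real.cos (α - β) := by
  rw [← Complex.normSq_eq_norm_sq, Complex.normSq_apply]
  simp only [Complex.polarCoord_symm_apply, Complex.sub_re, Complex.sub_im, Complex.mul_re,
    Complex.mul_im, Complex.add_re, Complex.add_im, Complex.ofReal_re, Complex.ofReal_im,
    Complex.I_re, Complex.I_im]
  rw [Real.cos_sub]
  linear_combination r ^ 2 * Real.sin_sq_add_cos_sq α + s ^ 2 * Real.sin_sq_add_cos_sq β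

lemma polar_zero (σ : ℝ) : Complex.polarCoord.symm (σ, 0) = (σ : ℂ) := by simp

/-- The part of the unit disc about `σ` in the closed annulus with radii `x` and `y`. -/
def discInAnnulus (σ x y : ℝ) : Set ℂ := closedBall (σ : ℂ) 1 ∩ complexAnnulus x y

lemma isClosed_discInAnnulus (σ x y : ℝ) : IsClosed (discInAnnulus σ x y) :=
  isClosed_closedBall.inter (isClosed_complexAnnulus x y)

lemma volume_angularSlice_discInAnnulus {σ x y r : ℝ} (hσ : 1 < σ) (hr0 : 0 < r) (hσr : |r - σ| ≤ 1)
    (hr : r ∈ Icc x y) :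
    volume (angularSlice (discInAnnulus σ x y) r) = ENNReal.ofReal (2 * halfAngle σ r) := by
  have hden : 0 < 2 * r * σ := by positivity
  have hq : 0 < (r ^ 2 + σ ^ 2 - 1) / (2 * r * σ) := div_pos (by nlinarith) hden
  have hlt : halfAngle σ r < Real.pi := by
    have : halfAngle σ r < Real.pi / 2 := Real.arccos_lt_pi_div_two.2 hq
    linarith [Real.pi_pos]
  have hmem : ∀ θ, Complex.polarCoord.symm (r, θ) ∈ discInAnnulus σ x y ↔
      (r ^ 2 + σ ^ 2 - 1) / (2 * r * σ) ≤ Real.cos θ := by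
    intro θ
    have h1 : Complex.polarCoord.symm (r, θ) ∈ complexAnnulus x y := by
      rwa [complexAnnulus, mem_ofPred_eq, norm_polarCoord_symm_of_pos hr0]
    have h2 := normSq_polar_sub_polar r σ θ 0
    rw [polar_zero, sub_zero] at h2
    rw [discInAnnulus, mem_inter_iff, and_iff_left h1, mem_closedBall, dist_eq_norm,
      div_le_iff₀ hden, ← sq_le_one_iff₀ (norm_nonneg _), h2]
    constructor <;> intro h <;> linarith
  have : angularSlice (discInAnnulus σ x y) r = Icc (-halfAngle σ r) (halfAngle σ r) := by
    ext θ
    rw [angularSlice, mem_ofPred_eq, hmem, mem_Icc, ← abs_le]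
    constructor
    · rintro ⟨hθ, hc⟩
      rw [← Real.cos_abs] at hc
      have := Real.arccos_le_arccos hc
      rwa [Real.arccos_cos (abs_nonneg _) (abs_le.2 ⟨hθ.1.le, hθ.2.le⟩)] at this
    · intro h
      refine ⟨abs_lt.1 (h.trans_lt hlt), ?_⟩
      rw [← Real.cos_abs]
      have h3 := Real.cos_le_cos_of_nonneg_of_le_pi (abs_nonneg θ) hlt.le h
      have h4 : (r ^ 2 + σ ^ 2 - 1) / (2 * r * σ) ≤ 1 := by
        rw [div_le_one hden]
        nlinarith [abs_le.1 hσr]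
      rwa [halfAngle, Real.cos_arccos (by linarith) h4] at h3
  rw [this, Real.volume_Icc]
  congr 1
  ring

lemma abs_sub_midpointNorm_le_one {x y r : ℝ} (hx : 2 ≤ x) (hxy : x ≤ y) (hyx : y - x ≤ 2)
    (hr : r ∈ Icc x y) : |r - midpointNorm x y| ≤ 1 := by
  have h1 := one_lt_midpointNorm hx hxy
  have h2 := midpointNorm_sq (y := y) hx
  rw [abs_le]
  constructor
  · have : midpointNorm x y ≤ x + 1 := Real.sqrt_le_iff.2 ⟨by linarith, by nlinarith⟩
    linarith [hr.1]
  · have : y - 1 ≤ midpointNorm x y := Real.le_sqrt_of_sq_le (by nlinarith)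
    linarith [hr.2]

/-- In terms of `Y = (r² - σ² - 1) / (2σ)`, the corresponding point of the unit circle about `σ`
is `σ + Y + i√(1 - Y²)`. -/
lemma sin_halfAngle {σ r : ℝ} (hσ : 1 < σ) (hr : 0 < r) :
    Real.sin (halfAngle σ r) = √(1 - ((r ^ 2 - σ ^ 2 - 1) / (2 * σ)) ^ 2) / r := by
  rw [halfAngle, Real.sin_arccos, eq_div_iff hr.ne']
  have : 1 - ((r ^ 2 - σ ^ 2 - 1) / (2 * σ)) ^ 2
      = (1 - ((r ^ 2 + σ ^ 2 - 1) / (2 * r * σ)) ^ 2) * r ^ 2 := by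
    field_simp
    ring
  rw [this, Real.sqrt_mul' _ (sq_nonneg r), Real.sqrt_sq hr.le]

lemma cos_halfAngle {σ r : ℝ} (hσ : 1 < σ) (hr : 0 < r) (hσr : |r - σ| ≤ 1) :
    Real.cos (halfAngle σ r) = (r ^ 2 + σ ^ 2 - 1) / (2 * r * σ) := by
  have hden : 0 < 2 * r * σ := by positivity
  refine Real.cos_arccos ?_ ?_
  · exact le_trans (by norm_num) (div_pos (by nlinarith) hden).le
  · rw [div_le_one hden]
    nlinarith [abs_le.1 hσr]

lemma halfAngle_nonneg (σ r : ℝ) : 0 ≤ halfAngle σ r := Real.arccos_nonneg _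

lemma halfAngle_lt_pi_div_two {σ r : ℝ} (hσ : 1 < σ) (hr : 0 < r) :
    halfAngle σ r < Real.pi / 2 :=
  Real.arccos_lt_pi_div_two.2 (div_pos (by nlinarith) (by positivity))

/-- Antipodal points of the unit circle about `σ` have distance `2`, and by the parallelogram law
the squares of their norms add up to `2σ² + 2`. Hence the half-angles at two such radii `r` and `s`
add up to the angle opposite to the side `2` in a triangle with sides `r`, `s`, `2`. -/
lemma halfAngle_add_halfAngle {σ r s : ℝ} (hσ : 1 < σ) (hr : 0 < r) (hs : 0 < s)
    (hσr : |r - σ| ≤ 1) (hσs : |s - σ| ≤ 1) (hrs : r ^ 2 + s ^ 2 = 2 * σ ^ 2 + 2) :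
    halfAngle σ r + halfAngle σ s = Real.arccos ((r ^ 2 + s ^ 2 - 4) / (2 * r * s)) := by
  have hσ0 : 0 < σ := by linarith
  have hY : ((s ^ 2 - σ ^ 2 - 1) / (2 * σ)) ^ 2 = ((r ^ 2 - σ ^ 2 - 1) / (2 * σ)) ^ 2 := by
    rw [show s ^ 2 - σ ^ 2 - 1 = -(r ^ 2 - σ ^ 2 - 1) by linarith, neg_div, neg_sq]
  have hY1 : 0 ≤ 1 - ((r ^ 2 - σ ^ 2 - 1) / (2 * σ)) ^ 2 := by
    rw [sub_nonneg, sq_le_one_iff_abs_le_one, abs_le, le_div_iff₀ (by positivity),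
      div_le_iff₀ (by positivity)]
    constructor <;> nlinarith [abs_le.1 hσr]
  have hcos : Real.cos (halfAngle σ r + halfAngle σ s) = (r ^ 2 + s ^ 2 - 4) / (2 * r * s) := by
    rw [Real.cos_add, sin_halfAngle hσ hr, sin_halfAngle hσ hs, hY, cos_halfAngle hσ hr hσr,
      cos_halfAngle hσ hs hσs, div_mul_div_comm _ r, Real.mul_self_sqrt hY1]
    field_simp
    have : s ^ 2 = 2 * σ ^ 2 + 2 - r ^ 2 := by linarith
    rw [this]
    ring
  rw [← hcos, Real.arccos_cos]
  · linarith [halfAngle_nonneg σ r, halfAngle_nonneg σ s]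
  · linarith [halfAngle_lt_pi_div_two hσ hr, halfAngle_lt_pi_div_two hσ hs]

/-! ### Comparison with the disc -/

/-- Two points with norms `r` and `s` and with distance at most `2`, both in the right half plane,
differ in argument by at most the angle opposite to the side `2` in a triangle with sides `r`, `s`
and `2`. -/
lemma abs_sub_le_arccos_of_dist_le {r s α β : ℝ} (hr : 0 < r) (hs : 0 < s)
    (hα : |α| ≤ Real.pi / 2) (hβ : |β| ≤ Real.pi / 2)
    (h : dist (Complex.polarCoord.symm (r, α)) (Complex.polarCoord.symm (s, β)) ≤ 2) :
    |α - β| ≤ Real.arccos ((r ^ 2 + s ^ 2 - 4) / (2 * r * s)) := by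
  have h1 := normSq_polar_sub_polar r s α β
  rw [dist_eq_norm] at h
  have h2 : (r ^ 2 + s ^ 2 - 4) / (2 * r * s) ≤ Real.cos (α - β) := by
    rw [div_le_iff₀ (by positivity)]
    nlinarith [norm_nonneg (Complex.polarCoord.symm (r, α) - Complex.polarCoord.symm (s, β))]
  rw [← Real.cos_abs] at h2
  have h3 := Real.arccos_le_arccos h2
  rwa [Real.arccos_cos (abs_nonneg _)] at h3
  exact (abs_sub _ _).trans (by linarith)

lemma abs_le_pi_div_two_of_mem_angularSlice {S : Set ℂ} (hre : ∀ z ∈ S, 0 < z.re) {r θ : ℝ}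
    (hr : 0 < r) (hθ : θ ∈ angularSlice S r) : |θ| ≤ Real.pi / 2 := by
  by_contra! h
  have h1 := hre _ hθ.2
  have h2 : Real.cos |θ| ≤ 0 := Real.cos_nonpos_of_pi_div_two_le_of_le h.le
    (by linarith [abs_lt.2 hθ.1, Real.pi_pos])
  rw [Real.cos_abs] at h2
  simp only [Complex.polarCoord_symm_apply, Complex.mul_re, Complex.add_re, Complex.ofReal_re,
    Complex.ofReal_im, Complex.I_re, Complex.I_im, Complex.add_im, Complex.mul_im] at h1
  nlinarith

lemma nonempty_angularSlice {S : Set ℂ} (hre : ∀ z ∈ S, 0 < z.re) {z : ℂ} (hz : z ∈ S) :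
    (angularSlice S ‖z‖).Nonempty := by
  have hz' : z ∈ Complex.polarCoord.source := Or.inl (hre z hz)
  have h := Complex.polarCoord.map_source hz'
  rw [Complex.polarCoord_apply, Complex.polarCoord_target] at h
  refine ⟨z.arg, h.2, ?_⟩
  rw [← Complex.polarCoord_apply, Complex.polarCoord.left_inv hz']
  exact hz

/-- Among the sets of diameter at most `2` whose points have norms in `[x, y]` and which meet each
circle of radius in `(x, y)`, the part of the unit disc about `midpointNorm x y` has the largest
area. The circle of radius `r` is compared together with that of radius `√(x² + y² - r²)`. -/
lemma volume_le_volume_discInAnnulus {S : Set ℂ} (hS : MeasurableSet S) {x y : ℝ} (hx : 2 ≤ x)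
    (hxy : x ≤ y) (hyx : y - x ≤ 2) (hsub : S ⊆ complexAnnulus x y) (hre : ∀ z ∈ S, 0 < z.re)
    (hdist : ∀ z ∈ S, ∀ w ∈ S, dist z w ≤ 2) (hall : ∀ r ∈ Ioo x y, ∃ z ∈ S, ‖z‖ = r) :
    volume S ≤ volume (discInAnnulus (midpointNorm x y) x y) := by
  have hσ := one_lt_midpointNorm hx hxy
  have hE := (isClosed_discInAnnulus (midpointNorm x y) x y).measurableSet
  rw [volume_eq_lintegral_of_subset_complexAnnulus hS hsub,
    volume_eq_lintegral_of_subset_complexAnnulus hE inter_subset_right]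
  refine lintegral_le_of_add_reflect_le (by linarith) (measurable_volume_angularSlice hS)
    (measurable_volume_angularSlice hE) fun r hr => ?_
  have hr0 : 0 < r := by linarith [hr.1]
  obtain ⟨s, hs_def⟩ : ∃ s, s = √(x ^ 2 + y ^ 2 - r ^ 2) := ⟨_, rfl⟩
  rw [← hs_def]
  have hs : s ∈ Ioo x y := by
    rw [hs_def]
    exact ⟨Real.lt_sqrt_of_sq_lt (by nlinarith [hr.1, hr.2]),
      (Real.sqrt_lt' (by linarith)).2 (by nlinarith [hr.1, hr.2])⟩
  have hs0 : 0 < s := by linarith [hs.1]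
  have hs2 : s ^ 2 = x ^ 2 + y ^ 2 - r ^ 2 := by
    rw [hs_def, Real.sq_sqrt (by nlinarith [hr.1, hr.2])]
  have hσr := abs_sub_midpointNorm_le_one hx hxy hyx (Ioo_subset_Icc_self hr)
  have hσs := abs_sub_midpointNorm_le_one hx hxy hyx (Ioo_subset_Icc_self hs)
  rw [volume_angularSlice_discInAnnulus hσ hr0 hσr (Ioo_subset_Icc_self hr),
    volume_angularSlice_discInAnnulus hσ hs0 hσs (Ioo_subset_Icc_self hs),
    ← ENNReal.ofReal_add (by linarith [halfAngle_nonneg (midpointNorm x y) r])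
      (by linarith [halfAngle_nonneg (midpointNorm x y) s]), ← mul_add,
    halfAngle_add_halfAngle hσ hr0 hs0 hσr hσs (by linarith [midpointNorm_sq (y := y) hx])]
  have hne : ∀ t ∈ Ioo x y, (angularSlice S t).Nonempty := fun t ht => by
    obtain ⟨z, hz, rfl⟩ := hall t ht
    exact nonempty_angularSlice hre hz
  exact volume_add_volume_le_of_abs_sub_le (hne r hr) (hne s hs) fun α hα β hβ =>
    abs_sub_le_arccos_of_dist_le hr0 hs0 (abs_le_pi_div_two_of_mem_angularSlice hre hr0 hα)
      (abs_le_pi_div_two_of_mem_angularSlice hre hs0 hβ) (hdist _ hα.2 _ hβ.2)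

/-! ### The area in closed form -/

/-- A primitive of `r ↦ 2 * r * halfAngle σ r`. -/
noncomputable def areaPrimitive (σ r : ℝ) : ℝ :=
  r ^ 2 * halfAngle σ r + Real.arcsin ((r ^ 2 - σ ^ 2 - 1) / (2 * σ))
    - σ * √(1 - ((r ^ 2 - σ ^ 2 - 1) / (2 * σ)) ^ 2)

lemma continuousOn_halfAngle {σ : ℝ} (hσ : 1 < σ) : ContinuousOn (halfAngle σ) (Ioi 0) := by
  refine Real.continuous_arccos.comp_continuousOn
    (ContinuousOn.div (by fun_prop) (by fun_prop) fun r hr => ?_)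
  have : (0 : ℝ) < r := hr
  positivity

lemma continuousOn_areaPrimitive {σ : ℝ} (hσ : 1 < σ) :
    ContinuousOn (areaPrimitive σ) (Ioi 0) := by
  have h1 := continuousOn_halfAngle hσ
  have h2 : Continuous fun r : ℝ => Real.arcsin ((r ^ 2 - σ ^ 2 - 1) / (2 * σ)) :=
    Real.continuous_arcsin.comp (by fun_prop)
  unfold areaPrimitive
  fun_prop

lemma hasDerivAt_areaPrimitive {σ r : ℝ} (hσ : 1 < σ) (hr : r ∈ Ioo (σ - 1) (σ + 1)) :
    HasDerivAt (areaPrimitive σ) (2 * r * halfAngle σ r) r := by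
  have hσ0 : 0 < σ := by linarith
  have hr0 : 0 < r := by linarith [hr.1]
  obtain ⟨Y, hY⟩ : ∃ Y, Y = (r ^ 2 - σ ^ 2 - 1) / (2 * σ) := ⟨_, rfl⟩
  have hY1 : -1 < Y := by
    rw [hY, lt_div_iff₀ (by positivity)]; nlinarith [hr.1, hr.2]
  have hY2 : Y < 1 := by
    rw [hY, div_lt_iff₀ (by positivity)]; nlinarith [hr.1, hr.2]
  have hpos : 0 < 1 - Y ^ 2 := by nlinarith
  have hX : (r ^ 2 + σ ^ 2 - 1) / (2 * r * σ) < 1 := by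
    rw [div_lt_one (by positivity)]; nlinarith [hr.1, hr.2]
  have hX' : -1 < (r ^ 2 + σ ^ 2 - 1) / (2 * r * σ) :=
    lt_trans (by norm_num) (div_pos (by nlinarith) (by positivity))
  have dX : HasDerivAt (fun r : ℝ => (r ^ 2 + σ ^ 2 - 1) / (2 * r * σ))
      ((r ^ 2 - σ ^ 2 + 1) / (2 * σ * r ^ 2)) r := by
    have h1 : HasDerivAt (fun r : ℝ => r ^ 2 + σ ^ 2 - 1) (2 * r) r := by
      simpa using ((hasDerivAt_pow 2 r).add_const (σ ^ 2)).sub_const 1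
    have h2 : HasDerivAt (fun r : ℝ => 2 * r * σ) (2 * σ) r := by
      simpa using ((hasDerivAt_id r).const_mul 2).mul_const σ
    refine (h1.div h2 (by positivity)).congr_deriv ?_
    field_simp
    ring
  have dh : HasDerivAt (halfAngle σ)
      (-(1 / (√(1 - Y ^ 2) / r)) * ((r ^ 2 - σ ^ 2 + 1) / (2 * σ * r ^ 2))) r := by
    have h3 := (Real.hasDerivAt_arccos hX'.ne' hX.ne).comp r dX
    rw [← Real.sin_arccos] at h3
    have h4 := sin_halfAngle hσ hr0
    rw [← hY] at h4
    rwa [← h4]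
  have dY : HasDerivAt (fun r : ℝ => (r ^ 2 - σ ^ 2 - 1) / (2 * σ)) (r / σ) r := by
    have h1 : HasDerivAt (fun r : ℝ => r ^ 2 - σ ^ 2 - 1) (2 * r) r := by
      simpa using ((hasDerivAt_pow 2 r).sub_const (σ ^ 2)).sub_const 1
    refine (h1.div_const (2 * σ)).congr_deriv ?_
    field_simp
  have das := (Real.hasDerivAt_arcsin (x := (r ^ 2 - σ ^ 2 - 1) / (2 * σ))
    (by rw [← hY]; exact hY1.ne') (by rw [← hY]; exact hY2.ne)).comp r dY
  have dsq : HasDerivAt (fun r : ℝ => √(1 - ((r ^ 2 - σ ^ 2 - 1) / (2 * σ)) ^ 2))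
      (-(2 * Y * (r / σ)) / (2 * √(1 - Y ^ 2))) r := by
    have h1 : HasDerivAt (fun r : ℝ => 1 - ((r ^ 2 - σ ^ 2 - 1) / (2 * σ)) ^ 2)
        (-(2 * Y * (r / σ))) r := by
      simpa [← hY] using (dY.fun_pow 2).const_sub 1
    simpa only [← hY] using h1.sqrt (by rw [← hY]; exact hpos.ne')
  have hsq := Real.sq_sqrt hpos.le
  have hs0 : 0 < √(1 - Y ^ 2) := Real.sqrt_pos.2 hpos
  refine (((hasDerivAt_pow 2 r).mul dh).add das |>.sub (dsq.const_mul σ)).congr_deriv ?_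
  rw [← hY]
  have hr2 : r ^ 2 = 2 * σ * Y + σ ^ 2 + 1 := by rw [hY]; field_simp; ring
  generalize √(1 - Y ^ 2) = q at *
  field_simp
  push_cast
  rw [hr2]
  ring

lemma intervalIntegrable_mul_halfAngle {σ x y : ℝ} (hσ : 1 < σ) (hx : 0 < x) (hxy : x ≤ y) :
    IntervalIntegrable (fun r => 2 * r * halfAngle σ r) volume x y := by
  refine ContinuousOn.intervalIntegrable ?_
  rw [uIcc_of_le hxy]
  exact ContinuousOn.mul (by fun_prop)
    ((continuousOn_halfAngle hσ).mono fun r hr => hx.trans_le hr.1)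

lemma integral_mul_halfAngle {σ x y : ℝ} (hσ : 1 < σ) (hσx : σ - 1 ≤ x) (hxy : x ≤ y)
    (hyσ : y ≤ σ + 1) :
    ∫ r in x..y, 2 * r * halfAngle σ r = areaPrimitive σ y - areaPrimitive σ x := by
  have hx0 : 0 < x := by linarith
  exact intervalIntegral.integral_eq_sub_of_hasDerivAt_of_le hxy
    ((continuousOn_areaPrimitive hσ).mono fun r hr => hx0.trans_le hr.1)
    (fun r hr => hasDerivAt_areaPrimitive hσ ⟨by linarith [hr.1], by linarith [hr.2]⟩)
    (intervalIntegrable_mul_halfAngle hσ hx0 hxy)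

lemma volume_discInAnnulus {σ x y : ℝ} (hσ : 1 < σ) (hσx : σ - 1 ≤ x) (hxy : x ≤ y)
    (hyσ : y ≤ σ + 1) :
    volume (discInAnnulus σ x y) = ENNReal.ofReal (areaPrimitive σ y - areaPrimitive σ x) := by
  have hx0 : 0 < x := by linarith
  have hint := intervalIntegrable_mul_halfAngle hσ hx0 hxy
  rw [volume_eq_lintegral_of_subset_complexAnnulus (isClosed_discInAnnulus σ x y).measurableSet
    inter_subset_right, ← integral_mul_halfAngle hσ hσx hxy hyσ,
    intervalIntegral.integral_of_le hxy, integral_Ioc_eq_integral_Ioo,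
    ofReal_integral_eq_lintegral_ofReal]
  · refine setLIntegral_congr_fun measurableSet_Ioo fun r hr => ?_
    have hr0 : 0 < r := hx0.trans hr.1
    rw [volume_angularSlice_discInAnnulus hσ hr0 (abs_le.2 ⟨by linarith [hr.1], by linarith [hr.2]⟩)
      (Ioo_subset_Icc_self hr), ← ENNReal.ofReal_mul hr0.le]
    congr 1
    ring
  · exact ((intervalIntegrable_iff_integrableOn_Ioc_of_le hxy).1 hint).mono_set Ioo_subset_Ioc_self
  · refine (ae_restrict_iff' measurableSet_Ioo).2 (Filter.Eventually.of_forall fun r hr => ?_)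
    have hr0 : 0 < r := hx0.trans hr.1
    have := halfAngle_nonneg σ r
    simp only [Pi.zero_apply]
    positivity

/-- The area of the part of the unit disc about `midpointNorm x y` in the annulus with radii
`x` and `y`. -/
noncomputable def discInAnnulusArea (x y : ℝ) : ℝ :=
  y ^ 2 * halfAngle (midpointNorm x y) y - x ^ 2 * halfAngle (midpointNorm x y) x
    + 2 * Real.arcsin ((y ^ 2 - x ^ 2) / (4 * midpointNorm x y))

lemma areaPrimitive_sub_areaPrimitive {x y : ℝ} (hx : 2 ≤ x) (hxy : x ≤ y) :
    areaPrimitive (midpointNorm x y) y - areaPrimitive (midpointNorm x y) x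
      = discInAnnulusArea x y := by
  have hσ := one_lt_midpointNorm hx hxy
  have h1 := midpointNorm_sq (y := y) hx
  unfold areaPrimitive discInAnnulusArea
  generalize midpointNorm x y = σ at *
  have hy' : (y ^ 2 - σ ^ 2 - 1) / (2 * σ) = (y ^ 2 - x ^ 2) / (4 * σ) := by
    rw [h1]; field_simp; ring
  have hx' : (x ^ 2 - σ ^ 2 - 1) / (2 * σ) = -((y ^ 2 - x ^ 2) / (4 * σ)) := by
    rw [h1]; field_simp; ring
  rw [hy', hx', Real.arcsin_neg, neg_sq]
  ring

lemma volume_discInAnnulus_midpointNorm {x y : ℝ} (hx : 2 ≤ x) (hxy : x ≤ y) (hyx : y - x ≤ 2) :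
    volume (discInAnnulus (midpointNorm x y) x y) = ENNReal.ofReal (discInAnnulusArea x y) := by
  have h1 := abs_le.1 (abs_sub_midpointNorm_le_one hx hxy hyx (left_mem_Icc.2 hxy))
  have h2 := abs_le.1 (abs_sub_midpointNorm_le_one hx hxy hyx (right_mem_Icc.2 hxy))
  rw [volume_discInAnnulus (one_lt_midpointNorm hx hxy) (by linarith) hxy (by linarith),
    areaPrimitive_sub_areaPrimitive hx hxy]

lemma discInAnnulusArea_nonneg {x y : ℝ} (hx : 2 ≤ x) (hxy : x ≤ y) (hyx : y - x ≤ 2) :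
    0 ≤ discInAnnulusArea x y := by
  have h1 := abs_le.1 (abs_sub_midpointNorm_le_one hx hxy hyx (left_mem_Icc.2 hxy))
  have h2 := abs_le.1 (abs_sub_midpointNorm_le_one hx hxy hyx (right_mem_Icc.2 hxy))
  rw [← areaPrimitive_sub_areaPrimitive hx hxy,
    ← integral_mul_halfAngle (one_lt_midpointNorm hx hxy) (by linarith) hxy (by linarith)]
  refine intervalIntegral.integral_nonneg hxy fun r hr => ?_
  have hr0 : 0 ≤ r := by linarith [hr.1]
  have := halfAngle_nonneg (midpointNorm x y) r
  positivity

/-! ### Monotonicity in the radii -/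

lemma continuousOn_discInAnnulusArea :
    ContinuousOn (fun p : ℝ × ℝ => discInAnnulusArea p.1 p.2) {p | 2 ≤ p.1 ∧ p.1 ≤ p.2} := by
  have hm : Continuous fun p : ℝ × ℝ => midpointNorm p.1 p.2 := by
    unfold midpointNorm; fun_prop
  have hm0 : ∀ p ∈ {p : ℝ × ℝ | 2 ≤ p.1 ∧ p.1 ≤ p.2}, midpointNorm p.1 p.2 ≠ 0 :=
    fun p hp => by linarith [one_lt_midpointNorm hp.1 hp.2]
  have hx0 : ∀ p ∈ {p : ℝ × ℝ | 2 ≤ p.1 ∧ p.1 ≤ p.2}, p.1 ≠ 0 := fun p hp => by linarith [hp.1]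
  have hy0 : ∀ p ∈ {p : ℝ × ℝ | 2 ≤ p.1 ∧ p.1 ≤ p.2}, p.2 ≠ 0 :=
    fun p hp => by linarith [hp.1, hp.2]
  have h1 : ContinuousOn (fun p : ℝ × ℝ => halfAngle (midpointNorm p.1 p.2) p.2)
      {p | 2 ≤ p.1 ∧ p.1 ≤ p.2} :=
    Real.continuous_arccos.comp_continuousOn <| ContinuousOn.div (by fun_prop) (by fun_prop)
      fun p hp => mul_ne_zero (mul_ne_zero two_ne_zero (hy0 p hp)) (hm0 p hp)
  have h2 : ContinuousOn (fun p : ℝ × ℝ => halfAngle (midpointNorm p.1 p.2) p.1)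
      {p | 2 ≤ p.1 ∧ p.1 ≤ p.2} :=
    Real.continuous_arccos.comp_continuousOn <| ContinuousOn.div (by fun_prop) (by fun_prop)
      fun p hp => mul_ne_zero (mul_ne_zero two_ne_zero (hx0 p hp)) (hm0 p hp)
  have h3 : ContinuousOn
      (fun p : ℝ × ℝ => Real.arcsin ((p.2 ^ 2 - p.1 ^ 2) / (4 * midpointNorm p.1 p.2)))
      {p | 2 ≤ p.1 ∧ p.1 ≤ p.2} :=
    Real.continuous_arcsin.comp_continuousOn <| ContinuousOn.div (by fun_prop) (by fun_prop)
      fun p hp => mul_ne_zero four_ne_zero (hm0 p hp)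
  unfold discInAnnulusArea
  fun_prop

/-- A slight enlargement `[x', y']` of `[x, y]` increases the maximal area, because the disc which
is optimal for `[x, y]` still meets all circles with radii in `[x', y']`. -/
lemma volume_discInAnnulus_le_of_near {x y x' y' : ℝ} (hx' : 2 ≤ x') (hxx : x' ≤ x) (hxy : x ≤ y)
    (hyy : y ≤ y') (hyx : y' - x' ≤ 2) (h1 : midpointNorm x y - 1 ≤ x')
    (h2 : y' ≤ midpointNorm x y + 1) :
    volume (discInAnnulus (midpointNorm x y) x y)
      ≤ volume (discInAnnulus (midpointNorm x' y') x' y') := by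
  have hσ := one_lt_midpointNorm (hx'.trans hxx) hxy
  have hmono : complexAnnulus x y ⊆ complexAnnulus x' y' :=
    fun z hz => ⟨hxx.trans hz.1, hz.2.trans hyy⟩
  refine (measure_mono (inter_subset_inter_right _ hmono)).trans
    (volume_le_volume_discInAnnulus (S := discInAnnulus (midpointNorm x y) x' y')
      (isClosed_discInAnnulus _ _ _).measurableSet hx' (by linarith) hyx inter_subset_right ?_ ?_ ?_)
  · intro z hz
    have h3 := hz.1
    rw [mem_closedBall, dist_eq_norm] at h3
    have h4 := (abs_le.1 ((Complex.abs_re_le_norm _).trans h3)).1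
    simp only [Complex.sub_re, Complex.ofReal_re] at h4
    linarith
  · intro z hz w hw
    have h3 := mem_closedBall.1 hz.1
    have h4 := mem_closedBall.1 hw.1
    linarith [dist_triangle_right z w (midpointNorm x y : ℂ)]
  · intro r hr
    have hn : ‖(r : ℂ)‖ = r := by
      rw [Complex.norm_real, Real.norm_of_nonneg (by linarith [hr.1])]
    refine ⟨r, ⟨?_, ?_⟩, hn⟩
    · rw [mem_closedBall, Complex.dist_eq, ← Complex.ofReal_sub, Complex.norm_real, Real.norm_eq_abs,
        abs_le]
      constructor <;> linarith [hr.1, hr.2]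
    · rw [complexAnnulus, mem_ofPred_eq, hn]
      exact ⟨hr.1.le, hr.2.le⟩

lemma volume_discInAnnulus_midpointNorm_le {x y R : ℝ} (hx : 2 ≤ x) (hxy : x ≤ y) (hyR : y ≤ R)
    (hR : R ≤ 4) :
    volume (discInAnnulus (midpointNorm x y) x y)
      ≤ volume (discInAnnulus (midpointNorm 2 R) 2 R) := by
  by_cases hne : x = 2 ∧ y = R
  · rw [hne.1, hne.2]
  have hlt : y - x < 2 := by
    by_contra! h
    exact hne ⟨by linarith, by linarith⟩
  -- Continuous induction along the segment from `(x, y)` to `(2, R)`.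
  set u : ℝ → ℝ := fun t => x + t * (2 - x) with hu
  set v : ℝ → ℝ := fun t => y + t * (R - y) with hv
  have hu_cont : Continuous u := by fun_prop
  have hv_cont : Continuous v := by fun_prop
  have hu2 : ∀ t ∈ Icc (0 : ℝ) 1, 2 ≤ u t := fun t ht => by
    simp only [hu]; nlinarith [ht.1, ht.2]
  have hux : ∀ t ∈ Icc (0 : ℝ) 1, u t ≤ x := fun t ht => by
    simp only [hu]; nlinarith [ht.1, ht.2]
  have hyv : ∀ t ∈ Icc (0 : ℝ) 1, y ≤ v t := fun t ht => by
    simp only [hv]; nlinarith [ht.1, ht.2]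
  have hv4 : ∀ t ∈ Icc (0 : ℝ) 1, v t ≤ R := fun t ht => by
    simp only [hv]; nlinarith [ht.1, ht.2]
  have huv : ∀ t ∈ Icc (0 : ℝ) 1, u t ≤ v t := fun t ht =>
    (hux t ht).trans (hxy.trans (hyv t ht))
  have hvu : ∀ t ∈ Icc (0 : ℝ) 1, v t - u t ≤ 2 := fun t ht => by
    linarith [hu2 t ht, hv4 t ht]
  have hcont : ContinuousOn (fun t => ENNReal.ofReal (discInAnnulusArea (u t) (v t)))
      (Icc 0 1) :=
    ENNReal.continuous_ofReal.comp_continuousOn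
      (continuousOn_discInAnnulusArea.comp (f := fun t => (u t, v t))
        (hu_cont.prodMk hv_cont).continuousOn fun t ht => ⟨hu2 t ht, huv t ht⟩)
  obtain ⟨V, hV⟩ : ∃ V, V = volume (discInAnnulus (midpointNorm x y) x y) := ⟨_, rfl⟩
  have hclosed : IsClosed
      ({t | V ≤ ENNReal.ofReal (discInAnnulusArea (u t) (v t))} ∩ Icc 0 1) := by
    rw [inter_comm]
    exact hcont.preimage_isClosed_of_isClosed isClosed_Icc isClosed_Ici
  have hzero : (0 : ℝ) ∈ {t | V ≤ ENNReal.ofReal (discInAnnulusArea (u t) (v t))} := by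
    rw [mem_ofPred_eq, hV, ← volume_discInAnnulus_midpointNorm (hu2 0 (by simp)) (huv 0 (by simp))
      (hvu 0 (by simp))]
    simp [hu, hv]
  have hall := hclosed.Icc_subset_of_forall_exists_gt hzero ?_
  · have h1 := hall (right_mem_Icc.2 zero_le_one)
    rw [mem_ofPred_eq, ← volume_discInAnnulus_midpointNorm (hu2 1 (by simp)) (huv 1 (by simp))
      (hvu 1 (by simp))] at h1
    simpa [hu, hv, hV] using h1
  · rintro t ⟨hVt, ht⟩ s hs
    have htI := Ico_subset_Icc_self ht
    have hgap : v t - u t < 2 := by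
      simp only [hu, hv]
      nlinarith [ht.1, ht.2]
    have hm := midpointNorm_sq (y := v t) (hu2 t htI)
    have hm1 := one_lt_midpointNorm (hu2 t htI) (huv t htI)
    have h1 : midpointNorm (u t) (v t) - 1 < u t := by
      nlinarith [hu2 t htI, huv t htI]
    have h2 : v t < midpointNorm (u t) (v t) + 1 := by
      nlinarith [hu2 t htI, huv t htI]
    have e1 : ∀ᶠ t' in nhdsWithin t (Ioi t), midpointNorm (u t) (v t) - 1 < u t' :=
      (hu_cont.continuousAt.eventually_const_lt h1).filter_mono nhdsWithin_le_nhds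
    have e2 : ∀ᶠ t' in nhdsWithin t (Ioi t), v t' < midpointNorm (u t) (v t) + 1 :=
      (hv_cont.continuousAt.eventually_lt_const h2).filter_mono nhdsWithin_le_nhds
    have e3 : ∀ᶠ t' in nhdsWithin t (Ioi t), t' ∈ Ioc t (min s 1) :=
      Ioc_mem_nhdsGT (lt_min hs ht.2)
    obtain ⟨t', h1', h2', h3'⟩ := (e1.and (e2.and e3)).exists
    have ht' : t' ∈ Icc (0 : ℝ) 1 := ⟨ht.1.trans h3'.1.le, h3'.2.trans (min_le_right _ _)⟩
    refine ⟨t', ?_, h3'.1, h3'.2.trans (min_le_left _ _)⟩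
    rw [mem_ofPred_eq] at hVt ⊢
    refine hVt.trans ?_
    rw [← volume_discInAnnulus_midpointNorm (hu2 t htI) (huv t htI) (hvu t htI),
      ← volume_discInAnnulus_midpointNorm (hu2 t' ht') (huv t' ht') (hvu t' ht')]
    refine volume_discInAnnulus_le_of_near (hu2 t' ht') ?_ (huv t htI) ?_ (hvu t' ht') h1'.le h2'.le
    · simp only [hu]; nlinarith [h3'.1]
    · simp only [hv]; nlinarith [h3'.1]

/-! ### Sets of diameter at most two -/

lemma exists_rotation_eq_norm (z : ℂ) : ∃ e : ℂ ≃ₗᵢ[ℝ] ℂ, e z = ‖z‖ := by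
  refine ⟨rotation (Circle.exp (-z.arg)), ?_⟩
  rw [rotation_apply, Circle.coe_exp]
  nth_rewrite 2 [← Complex.norm_mul_exp_arg_mul_I z]
  rw [mul_left_comm, ← Complex.exp_add]
  simp

/-- The bound for closed convex sets, whose norms fill an interval in the annulus: after a rotation,
a point of least norm lies on the positive real axis, and the set in the right half plane. -/
lemma volume_inter_complexAnnulus_le {C : Set ℂ} (hC : IsClosed C) (hconv : Convex ℝ C)
    (hdist : ∀ z ∈ C, ∀ w ∈ C, dist z w ≤ 2) {R : ℝ} (hR : R ≤ 4) :
    volume (C ∩ complexAnnulus 2 R) ≤ volume (discInAnnulus (midpointNorm 2 R) 2 R) := by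
  set S := C ∩ complexAnnulus 2 R with hS
  rcases S.eq_empty_or_nonempty with hemp | hne
  · simp [hemp]
  have hScl : IsClosed S := hC.inter (isClosed_complexAnnulus 2 R)
  have hScomp : IsCompact S := isCompact_of_isClosed_isBounded hScl
    (isBounded_iff.2 ⟨2, fun z hz w hw => hdist z hz.1 w hw.1⟩)
  obtain ⟨z, hz, hzmin⟩ := hScomp.exists_isMinOn hne continuous_norm.continuousOn
  obtain ⟨w, hw, hwmax⟩ := hScomp.exists_isMaxOn hne continuous_norm.continuousOn
  have hzw : ‖z‖ ≤ ‖w‖ := hzmin hw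
  have hgap : ‖w‖ - ‖z‖ ≤ 2 :=
    (norm_sub_norm_le w z).trans ((dist_eq_norm w z).ge.trans (hdist w hw.1 z hz.1))
  obtain ⟨e, he⟩ := exists_rotation_eq_norm z
  have hvol : volume (e.symm ⁻¹' S) = volume S :=
    e.symm.measurePreserving.measure_preimage hScl.measurableSet.nullMeasurableSet
  rw [← hvol]
  have hdist' : ∀ a ∈ e.symm ⁻¹' S, ∀ b ∈ e.symm ⁻¹' S, dist a b ≤ 2 := fun a ha b hb => by
    rw [← e.symm.dist_map]
    exact hdist _ ha.1 _ hb.1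
  refine (volume_le_volume_discInAnnulus (x := ‖z‖) (y := ‖w‖)
    (hScl.preimage e.symm.continuous).measurableSet hz.2.1 hzw hgap ?_ ?_ hdist' ?_).trans
    (volume_discInAnnulus_midpointNorm_le hz.2.1 hzw hw.2.2 hR)
  · intro a ha
    rw [complexAnnulus, mem_ofPred_eq, ← e.symm.norm_map a]
    exact ⟨hzmin ha, hwmax ha⟩
  · -- A point of norm at least `2` within distance `2` of the point `‖z‖` of the real axis.
    intro a ha
    have h1 : ‖a - (‖z‖ : ℂ)‖ ≤ 2 := by
      rw [← dist_eq_norm]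
      refine hdist' a ha _ ?_
      rw [mem_preimage, ← he, e.symm_apply_apply]
      exact hz
    have h2 : 2 ≤ ‖a‖ := by
      rw [← e.symm.norm_map a]; exact ha.2.1
    have h3 : ‖a - (‖z‖ : ℂ)‖ ^ 2 = ‖a‖ ^ 2 - 2 * ‖z‖ * a.re + ‖z‖ ^ 2 := by
      rw [← Complex.normSq_eq_norm_sq, ← Complex.normSq_eq_norm_sq a, Complex.normSq_apply,
        Complex.normSq_apply]
      simp only [Complex.sub_re, Complex.sub_im, Complex.ofReal_re, Complex.ofReal_im]
      ring
    have h4 := hz.2.1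
    by_contra! h5
    nlinarith [norm_nonneg (a - (‖z‖ : ℂ))]
  · intro r hr
    obtain ⟨b, hb, rfl⟩ := hconv.isPreconnected.intermediate_value hz.1 hw.1
      continuous_norm.continuousOn (Ioo_subset_Icc_self hr)
    refine ⟨e b, ?_, e.norm_map b⟩
    rw [mem_preimage, e.symm_apply_apply]
    exact ⟨hb, hz.2.1.trans hr.1.le, hr.2.le.trans hw.2.2⟩

lemma volume_le_of_diam_le {S : Set ℂ} {R : ℝ} (hR : R ≤ 4) (hS : S ⊆ complexAnnulus 2 R)
    (hdiam : diam S ≤ 2) :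
    volume S ≤ volume (discInAnnulus (midpointNorm 2 R) 2 R) := by
  have hbdd : Bornology.IsBounded S :=
    isBounded_closedBall.subset fun z hz => mem_closedBall_zero_iff.2 (hS hz).2
  have hhull : Bornology.IsBounded (closure (convexHull ℝ S)) :=
    (isBounded_convexHull.2 hbdd).closure
  have hsub : S ⊆ closure (convexHull ℝ S) := (subset_convexHull ℝ S).trans subset_closure
  refine (measure_mono (subset_inter hsub hS)).trans
    (volume_inter_complexAnnulus_le isClosed_closure (convex_convexHull ℝ S).closure
      (fun z hz w hw => ?_) hR)
  refine (dist_le_diam_of_mem hhull hz hw).trans ?_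
  rwa [diam_closure, convexHull_diam]

/-! ### The extremal set in the Euclidean plane -/

lemma preimage_annulus (R : ℝ) :
    Complex.orthonormalBasisOneI.repr ⁻¹' annulus R = complexAnnulus 2 R := by
  ext z
  rw [mem_preimage, annulus, interior_closedBall _ two_ne_zero, mem_sdiff,
    mem_closedBall_zero_iff, mem_ball_zero_iff, LinearIsometryEquiv.norm_map, not_lt, and_comm]
  rfl

/-- The half-height, half-width and horizontal position of the rectangle spanned by the corners of
the extremal set, in terms of the norm of its centre. -/
lemma extremal_params {R : ℝ} (hR : R ∈ Icc 2 4) :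
    cornerHeight R = √(1 - ((R ^ 2 - 4) / (4 * midpointNorm 2 R)) ^ 2) ∧
    √(1 - cornerHeight R ^ 2) = (R ^ 2 - 4) / (4 * midpointNorm 2 R) ∧
    √(4 - cornerHeight R ^ 2) = midpointNorm 2 R - (R ^ 2 - 4) / (4 * midpointNorm 2 R) := by
  obtain ⟨hR2, hR4⟩ := hR
  have hσ := one_lt_midpointNorm le_rfl hR2
  have hσ2 := midpointNorm_sq (x := 2) (y := R) le_rfl
  set σ := midpointNorm 2 R
  obtain ⟨Y, hY⟩ : ∃ Y, Y = (R ^ 2 - 4) / (4 * σ) := ⟨_, rfl⟩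
  rw [← hY]
  have hσY : 4 * σ * Y = R ^ 2 - 4 := by rw [hY]; field_simp
  have hY0 : 0 ≤ Y := by rw [hY]; exact div_nonneg (by nlinarith) (by linarith)
  have hY1 : Y ≤ 1 := by
    rw [hY, div_le_one (by positivity)]
    refine abs_le_of_sq_le_sq' ?_ (by linarith) |>.2
    rw [mul_pow, hσ2]
    nlinarith [mul_nonneg (sq_nonneg R) (by nlinarith : 0 ≤ 16 - R ^ 2)]
  have ha : cornerHeight R = √(1 - Y ^ 2) := by
    rw [cornerHeight, hY, div_pow, mul_pow, hσ2]
    congr 1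
    have : (2 : ℝ) ^ 2 + R ^ 2 - 2 ≠ 0 := by nlinarith [sq_nonneg R]
    field_simp
    ring
  have ha2 : cornerHeight R ^ 2 = 1 - Y ^ 2 := by rw [ha, Real.sq_sqrt (by nlinarith)]
  refine ⟨ha, ?_, ?_⟩
  · rw [ha2, sub_sub_cancel, Real.sqrt_sq hY0]
  · rw [ha2, show 4 - (1 - Y ^ 2) = (σ - Y) ^ 2 by nlinarith, Real.sqrt_sq (by linarith)]

lemma extremalCenter_eq {R : ℝ} (hR : R ∈ Icc 2 4) :
    extremalCenter R = Complex.orthonormalBasisOneI.repr (midpointNorm 2 R : ℂ) := by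
  obtain ⟨-, h1, h2⟩ := extremal_params hR
  rw [extremalCenter, h1, h2, sub_add_cancel]
  ext i
  rw [Complex.orthonormalBasisOneI_repr_apply]
  fin_cases i <;> simp

lemma preimage_extremal {R : ℝ} (hR : R ∈ Icc 2 4) :
    Complex.orthonormalBasisOneI.repr ⁻¹' (closedBall (extremalCenter R) 1 ∩ annulus R)
      = discInAnnulus (midpointNorm 2 R) 2 R := by
  rw [preimage_inter, preimage_annulus, extremalCenter_eq hR, LinearIsometryEquiv.preimage_closedBall,
    LinearIsometryEquiv.symm_apply_apply]
  rfl

lemma halfAngle_eq_arcsin {σ r : ℝ} (hσ : 1 < σ) (hr : 0 < r) :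
    halfAngle σ r = Real.arcsin (√(1 - ((r ^ 2 - σ ^ 2 - 1) / (2 * σ)) ^ 2) / r) := by
  rw [← sin_halfAngle hσ hr, Real.arcsin_sin] <;>
  linarith [halfAngle_nonneg σ r, halfAngle_lt_pi_div_two hσ hr, Real.pi_pos]

lemma discInAnnulusArea_eq_annulusBound {R : ℝ} (hR : R ∈ Icc 2 4) :
    discInAnnulusArea 2 R = annulusBound R := by
  obtain ⟨ha, hY, -⟩ := extremal_params hR
  have hσ := one_lt_midpointNorm le_rfl hR.1
  have hσ2 := midpointNorm_sq (x := 2) (y := R) le_rfl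
  have hR0 : 0 < R := by linarith [hR.1]
  rw [discInAnnulusArea, annulusBound, halfAngle_eq_arcsin hσ hR0, halfAngle_eq_arcsin hσ two_pos]
  set σ := midpointNorm 2 R
  have hR' : (R ^ 2 - σ ^ 2 - 1) / (2 * σ) = (R ^ 2 - 4) / (4 * σ) := by
    rw [hσ2]; field_simp; ring
  have h2' : ((2 : ℝ) ^ 2 - σ ^ 2 - 1) / (2 * σ) = -((R ^ 2 - 4) / (4 * σ)) := by
    rw [hσ2]; field_simp; ring
  have ha0 : 0 ≤ cornerHeight R := Real.sqrt_nonneg _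
  rw [hR', h2', neg_sq, ← ha, Real.arccos_eq_arcsin ha0, hY, show (2 : ℝ) ^ 2 = 4 by norm_num]

theorem theorem3 (R : ℝ) (hR : R ∈ Icc (2 * Real.sqrt 2) 4) :
    (∀ A : Set (EuclideanSpace ℝ (Fin 2)),
      NullMeasurableSet A volume → A ⊆ annulus R → diam A ≤ 2 →
        (volume A).toReal ≤ annulusBound R) ∧
    diam (closedBall (extremalCenter R) 1 ∩ annulus R) ≤ 2 ∧
    (volume (closedBall (extremalCenter R) 1 ∩ annulus R)).toReal = annulusBound R := by
  have hR' : R ∈ Icc 2 4 := by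
    refine ⟨?_, hR.2⟩
    have : (1 : ℝ) ≤ √2 := Real.one_le_sqrt.2 one_le_two
    linarith [hR.1]
  have hgap : R - 2 ≤ 2 := by linarith [hR'.2]
  have hmp := Complex.orthonormalBasisOneI.repr.measurePreserving
  have harea : volume (discInAnnulus (midpointNorm 2 R) 2 R) = ENNReal.ofReal (annulusBound R) := by
    rw [volume_discInAnnulus_midpointNorm le_rfl hR'.1 hgap, discInAnnulusArea_eq_annulusBound hR']
  have hnonneg : 0 ≤ annulusBound R := by
    rw [← discInAnnulusArea_eq_annulusBound hR']
    exact discInAnnulusArea_nonneg le_rfl hR'.1 hgap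
  refine ⟨fun A hA hsub hdiam => ?_, ?_, ?_⟩
  · refine ENNReal.toReal_le_of_le_ofReal hnonneg ?_
    rw [← harea, ← hmp.measure_preimage hA]
    refine volume_le_of_diam_le hR'.2 ?_ ?_
    · rw [← preimage_annulus]
      exact preimage_mono hsub
    · exact (Complex.orthonormalBasisOneI.repr.toIsometryEquiv.diam_preimage A).trans_le hdiam
  · refine (diam_mono inter_subset_left isBounded_closedBall).trans ?_
    simpa using diam_closedBall (x := extremalCenter R) zero_le_one
  · have hmeas : MeasurableSet (closedBall (extremalCenter R) 1 ∩ annulus R) :=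
      measurableSet_closedBall.inter
        (measurableSet_closedBall.diff isOpen_interior.measurableSet)
    rw [← hmp.measure_preimage hmeas.nullMeasurableSet, preimage_extremal hR', harea,
      ENNReal.toReal_ofReal hnonneg]
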